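/- Let $\Gamma$ be a finite simple graph with vertex set $V$, $|V|=n$, and without $4$-cliques. The link of a clique $\sigma$ is the set of vertices outside $\sigma$ adjacent to every vertex of $\sigma$. Assume that $\Gamma$ is link-regular (the size of the link of a clique depends only on the size of the clique), that every vertex has degree $l$, and that the link of every edge has exactly $q$ elements. Let $A_\Gamma=\langle V\mid uv=vu\ \text{for all edges}\ \{u,v\}\rangle$ be the right-angled Artin group of $\Gamma$. A word over the alphabet $V\sqcup V^{-1}$ is geodesic if no shorter word over this alphabet represents the same element of $A_\Gamma$. Let $\mathcal A(z)=\sum_{k\ge 0}a_kz^k$ be the geodesic growth series, where $a_k$ is the number of geodesic words of length $k$. Put $$F_{n,l,q}(z)=\frac{nz\left(1+(5-l-q)z+(lq-3l+6)z^2\right)}{1+(6-n-l-q)z+(nl+lq+qn-5n-3l-q+11)z^2+(3nl+6-nlq-6n)z^3}.$$ Then, as formal power series, $\mathcal A(z)-1=F_{2n,2l,2q}(z)$, that is, $$\mathcal A(z)-1=\frac{2nz\left(1+(5-2l-2q)z+(4lq-6l+6)z^2\right)}{1+(6-2n-2l-2q)z+(4nl+4lq+4qn-10n-6l-2q+11)z^2+(12nl+6-8nlq-12n)z^3}.$$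 -/

import Mathlib

open PowerSeries

namespace GeodesicGrowth

/-- The value in `G` of a word `w` over the alphabet `X`, where the letter `x` stands for `ι x`;
this is the monoid morphism from `X^*` to `G` determined by `ι`. -/
def wordValue {X G : Type*} [Monoid G] (ι : X → G) (w : List X) : G :=
  (w.map ι).prod

/-- A word is geodesic if no word with the same value is shorter. -/
def IsGeodesicWord {X G : Type*} [Monoid G] (ι : X → G) (w : List X) : Prop :=
  ∀ u : List X, wordValue ι w = wordValue ι u → w.length ≤ u.length

/-- The geodesic growth series: its `k`-th coefficient is the number of geodesic words
of length `k` over the (finite) alphabet `X`. -/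
noncomputable def geodesicGrowthSeries {X G : Type*} [Monoid G] (ι : X → G) : ℤ⟦X⟧ :=
  PowerSeries.mk fun k => (({w : List X | w.length = k ∧ IsGeodesicWord ι w}.ncard : ℕ) : ℤ)

/-- The right-angled Artin group of a graph: one generator for each vertex, and the relation
that `u` and `v` commute for each edge `{u, v}`. -/
abbrev RAAG {V : Type*} (Γ : SimpleGraph V) : Type _ :=
  PresentedGroup {r : FreeGroup V | ∃ u v : V, Γ.Adj u v ∧
    r = FreeGroup.of u * FreeGroup.of v * (FreeGroup.of u)⁻¹ * (FreeGroup.of v)⁻¹}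

/-- The standard generating set of the right-angled Artin group: the disjoint union of the
vertices (left summand) and their formal inverses (right summand). -/
def raagLetter {V : Type*} (Γ : SimpleGraph V) : V ⊕ V → RAAG Γ
  | Sum.inl v => PresentedGroup.of v
  | Sum.inr v => (PresentedGroup.of v)⁻¹

/-- The link of a set `σ` of vertices: the vertices outside `σ` that span a clique with `σ`. -/
def link {V : Type*} (Γ : SimpleGraph V) (σ : Set V) : Set V :=
  {v | v ∉ σ ∧ Γ.IsClique (insert v σ)}

/-- A (finite) graph is link-regular if the size of the link of a clique depends only on the
size of the clique. -/
def IsLinkRegular {V : Type*} (Γ : SimpleGraph V) : Prop :=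
  ∀ σ τ : Set V, Γ.IsClique σ → Γ.IsClique τ → σ.ncard = τ.ncard →
    (link Γ σ).ncard = (link Γ τ).ncard

/-- The rational function in `n`, `l`, `q` (expanded as a power series) that gives the geodesic
growth series minus `1` of the right-angled Coxeter group of a link-regular graph without
`4`-cliques, with `n` vertices, vertex links of size `l` and edge links of size `q`.
The inverse is a genuine one, as the denominator has constant coefficient `1`. -/
noncomputable def coxeterFormula (n l q : ℚ⟦X⟧) : ℚ⟦X⟧ :=
  (n * X * (1 + (5 - l - q) * X + (l * q - 3 * l + 6) * X ^ 2)) *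
    (1 + (6 - n - l - q) * X
      + (n * l + l * q + q * n - 5 * n - 3 * l - q + 11) * X ^ 2
      + (3 * n * l + 6 - n * l * q - 6 * n) * X ^ 3)⁻¹

end GeodesicGrowth

/-! Each element of the group has a well-defined piling: left multiplication by a letter stacks a
sign on its vertex and blanks on the other vertices not commuting with it, or cancels an opposite
sign on top. The number of signs is the word length of the element (`isGeodesicWord_iff`), so a word
is geodesic iff no letter cancels while the piling is built.

The vertices with a sign on top form a clique `D`, of size at most 3. Adding `v` without
cancellation turns `D` into `{v} ∪ (D ∩ N(v))`, and by regularity the number of `v` with a given `|D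
∩ N(v)|` depends on `|D|` alone. Hence sums over geodesic words of functions of `|D|` obey a linear
recurrence on a four-dimensional space; eliminating three unknown series gives the formula. -/

namespace GeodesicGrowth

/-! ### Pilings and the action of the group on them -/

section Piling

variable {V : Type*}

/-- The vertex underlying a letter. -/
def letterVertex : V ⊕ V → V := Sum.elim id id

variable (Γ : SimpleGraph V)

/-- The generator attached to `v` or its inverse, according to the sign `b`. -/
def signedGen (v : V) : Bool → RAAG Γ
  | true => PresentedGroup.of v
  | false => (PresentedGroup.of v)⁻¹

theorem raagLetter_eq_signedGen (x : V ⊕ V) :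
    raagLetter Γ x = signedGen Γ (letterVertex x) x.isLeft := by
  cases x <;> rfl

@[simp]
theorem signedGen_not (v : V) (b : Bool) : signedGen Γ v (!b) = (signedGen Γ v b)⁻¹ := by
  cases b <;> simp [signedGen]

theorem commute_of {u v : V} (h : Γ.Adj u v) :
    Commute (PresentedGroup.of u : RAAG Γ) (PresentedGroup.of v) := by
  have := PresentedGroup.one_of_mem (rels := {r : FreeGroup V | ∃ u v : V, Γ.Adj u v ∧
    r = FreeGroup.of u * FreeGroup.of v * (FreeGroup.of u)⁻¹ * (FreeGroup.of v)⁻¹})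
    ⟨u, v, h, rfl⟩
  simp only [map_mul, map_inv] at this
  rw [mul_inv_eq_one, mul_inv_eq_iff_eq_mul] at this
  exact this

theorem commute_signedGen {u v : V} (h : Γ.Adj u v) (a b : Bool) :
    Commute (signedGen Γ u a) (signedGen Γ v b) := by
  cases a <;> cases b <;> simp [signedGen, commute_of Γ h]

open Classical in
/-- Put the sign `b` on the pile of `v` and a blank on the piles of the other vertices that do not
commute with `v`. A piling is a family of such piles. -/
noncomputable def push (v : V) (b : Bool) (p : V → List (Option Bool)) : V → List (Option Bool) :=
  fun u => if u = v then some b :: p u else if Γ.Adj v u then p u else none :: p u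

open Classical in
/-- Remove the top entry of all piles of vertices not adjacent to `v`. -/
noncomputable def pop (v : V) (p : V → List (Option Bool)) : V → List (Option Bool) :=
  fun u => if Γ.Adj v u then p u else (p u).tail

open Classical in
/-- The action of a signed generator on pilings. -/
noncomputable def act (v : V) (b : Bool) (p : V → List (Option Bool)) : V → List (Option Bool) :=
  if (p v).head? = some (some !b) then pop Γ v p else push Γ v b p

/-- The pilings of elements of the group, built letter by letter without cancellation. -/
inductive IsPilingOf : RAAG Γ → (V → List (Option Bool)) → Prop
  | nil : IsPilingOf 1 fun _ => []
  | cons {g : RAAG Γ} {p : V → List (Option Bool)} (v : V) (b : Bool) (h : IsPilingOf g p)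
      (hv : (p v).head? ≠ some (some !b)) : IsPilingOf (signedGen Γ v b * g) (push Γ v b p)

theorem push_apply_self (v : V) (b : Bool) (p : V → List (Option Bool)) :
    push Γ v b p v = some b :: p v := by
  simp [push]

variable {Γ}

theorem push_apply_of_adj {u v : V} (h : Γ.Adj v u) (b : Bool) (p : V → List (Option Bool)) :
    push Γ v b p u = p u := by
  simp [push, h, h.ne']

theorem push_apply_of_not_adj {u v : V} (hne : u ≠ v) (h : ¬ Γ.Adj v u) (b : Bool)
    (p : V → List (Option Bool)) : push Γ v b p u = none :: p u := by
  simp [push, h, hne]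

theorem pop_apply_of_adj {u v : V} (h : Γ.Adj v u) (p : V → List (Option Bool)) :
    pop Γ v p u = p u := by
  simp [pop, h]

theorem act_apply_of_adj {u v : V} (h : Γ.Adj v u) (b : Bool) (p : V → List (Option Bool)) :
    act Γ v b p u = p u := by
  unfold act
  split_ifs
  · exact pop_apply_of_adj h p
  · exact push_apply_of_adj h b p

theorem pop_push (v : V) (b : Bool) (p : V → List (Option Bool)) :
    pop Γ v (push Γ v b p) = p := by
  funext u
  by_cases h : Γ.Adj v u
  · rw [pop_apply_of_adj h, push_apply_of_adj h]
  · by_cases hu : u = v <;> simp [pop, push, h, hu]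

theorem push_comm {u v : V} (h : Γ.Adj u v) (a b : Bool) (p : V → List (Option Bool)) :
    push Γ u a (push Γ v b p) = push Γ v b (push Γ u a p) := by
  funext w
  by_cases hu : w = u
  · subst hu
    rw [push_apply_self, push_apply_of_adj h.symm, push_apply_of_adj h.symm, push_apply_self]
  by_cases hv : w = v
  · subst hv
    rw [push_apply_self, push_apply_of_adj h, push_apply_of_adj h, push_apply_self]
  · simp only [push, hu, hv, if_false]
    split_ifs <;> rfl

theorem pop_comm (u v : V) (p : V → List (Option Bool)) :
    pop Γ u (pop Γ v p) = pop Γ v (pop Γ u p) := by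
  funext w
  simp only [pop]
  split_ifs <;> rfl

/-- A letter added after the sign on top of `v` must commute with `v`, since otherwise it would have
left a blank there; so that sign can be moved past it and made the last one added. -/
theorem IsPilingOf.exists_eq_push {g : RAAG Γ} {p : V → List (Option Bool)}
    (hp : IsPilingOf Γ g p) {v : V} {b : Bool} (h : (p v).head? = some (some b)) :
    ∃ p', IsPilingOf Γ (signedGen Γ v (!b) * g) p' ∧ p = push Γ v b p' ∧
      (p' v).head? ≠ some (some !b) := by
  induction hp with
  | nil => simp at h
  | @cons g p y c hp hy ih =>
    by_cases hyv : v = y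
    · subst hyv
      rw [push_apply_self] at h
      obtain rfl : c = b := by simpa using h
      exact ⟨p, by simpa using hp, rfl, hy⟩
    by_cases hadj : Γ.Adj y v
    · rw [push_apply_of_adj hadj] at h
      obtain ⟨p', hp', rfl, hv⟩ := ih h
      refine ⟨push Γ y c p', ?_, push_comm hadj _ _ _, ?_⟩
      · rw [← mul_assoc, (commute_signedGen Γ hadj.symm _ _).eq, mul_assoc]
        refine hp'.cons y c ?_
        rwa [push_apply_of_adj hadj.symm] at hy
      · rwa [push_apply_of_adj hadj]
    · rw [push_apply_of_not_adj hyv hadj] at h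
      simp at h

theorem IsPilingOf.signedGen_mul {g : RAAG Γ} {p : V → List (Option Bool)} (hp : IsPilingOf Γ g p)
    (v : V) (b : Bool) : IsPilingOf Γ (signedGen Γ v b * g) (act Γ v b p) := by
  unfold act
  split_ifs with h
  · obtain ⟨p', hp', rfl, -⟩ := hp.exists_eq_push h
    rw [Bool.not_not] at hp'
    rwa [pop_push]
  · exact hp.cons v b h

theorem IsPilingOf.act_not_act {g : RAAG Γ} {p : V → List (Option Bool)}
    (hp : IsPilingOf Γ g p) (v : V) (b : Bool) :
    act Γ v (!b) (act Γ v b p) = p := by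
  by_cases h : (p v).head? = some (some !b)
  · obtain ⟨p', -, rfl, hv⟩ := hp.exists_eq_push h
    rw [act.eq_def Γ v b, if_pos h, pop_push, act, if_neg hv]
  · rw [act.eq_def Γ v b, if_neg h, act, push_apply_self, if_pos,
      pop_push]
    simp

/-- This fails for arbitrary families of piles: at a third vertex adjacent to neither `u` nor `v`,
the removed entry has to be a blank. -/
theorem IsPilingOf.pop_push_comm {g : RAAG Γ} {p : V → List (Option Bool)}
    (hp : IsPilingOf Γ g p) {u v : V} (h : Γ.Adj u v) {a : Bool} (b : Bool)
    (hu : (p u).head? = some (some a)) :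
    pop Γ u (push Γ v b p) = push Γ v b (pop Γ u p) := by
  obtain ⟨p', -, rfl, -⟩ := hp.exists_eq_push hu
  rw [push_comm h.symm, pop_push, pop_push]

theorem IsPilingOf.act_comm {g : RAAG Γ} {p : V → List (Option Bool)} (hp : IsPilingOf Γ g p)
    {u v : V} (h : Γ.Adj u v) (a b : Bool) :
    act Γ u a (act Γ v b p) =
      act Γ v b (act Γ u a p) := by
  rw [act.eq_def Γ u a, act.eq_def Γ v b (act Γ u a p),
    act_apply_of_adj h.symm, act_apply_of_adj h]
  unfold act
  split_ifs with hu hv hv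
  · exact pop_comm u v p
  · exact hp.pop_push_comm h b hu
  · exact (hp.pop_push_comm h.symm a hv).symm
  · exact push_comm h a b p

variable (Γ)

/-- The pilings of the elements of the group. -/
abbrev Piling : Type _ := {p : V → List (Option Bool) // ∃ g : RAAG Γ, IsPilingOf Γ g p}

/-- The permutation of the pilings given by a generator. -/
noncomputable def actPerm (v : V) : Equiv.Perm (Piling Γ) where
  toFun p := ⟨act Γ v true p.1, _, p.2.choose_spec.signedGen_mul v true⟩
  invFun p := ⟨act Γ v false p.1, _, p.2.choose_spec.signedGen_mul v false⟩
  left_inv p := Subtype.ext (p.2.choose_spec.act_not_act v true)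
  right_inv p := Subtype.ext (p.2.choose_spec.act_not_act v false)

theorem actPerm_comm {u v : V} (h : Γ.Adj u v) :
    actPerm Γ u * actPerm Γ v = actPerm Γ v * actPerm Γ u :=
  Equiv.ext fun p => Subtype.ext (p.2.choose_spec.act_comm h true true)

/-- The action of the group on pilings. -/
noncomputable def pilingAction : RAAG Γ →* Equiv.Perm (Piling Γ) :=
  PresentedGroup.toGroup (f := actPerm Γ) <| by
    rintro _ ⟨u, v, h, rfl⟩
    simp only [map_mul, map_inv, FreeGroup.lift_apply_of]
    rw [mul_inv_eq_one, mul_inv_eq_iff_eq_mul, actPerm_comm Γ h]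

theorem pilingAction_signedGen (v : V) (b : Bool) (p : Piling Γ) :
    (pilingAction Γ (signedGen Γ v b) p).1 = act Γ v b p.1 := by
  cases b
  · simp only [signedGen, map_inv, pilingAction, PresentedGroup.toGroup.of]
    rfl
  · simp only [signedGen, pilingAction, PresentedGroup.toGroup.of]
    rfl

/-- The piling of a word. -/
noncomputable def wordPiling : List (V ⊕ V) → V → List (Option Bool)
  | [] => fun _ => []
  | x :: w => act Γ (letterVertex x) x.isLeft (wordPiling w)

theorem wordValue_cons (x : V ⊕ V) (w : List (V ⊕ V)) :
    wordValue (raagLetter Γ) (x :: w) =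
      signedGen Γ (letterVertex x) x.isLeft * wordValue (raagLetter Γ) w := by
  simp [wordValue, raagLetter_eq_signedGen]

theorem isPilingOf_wordPiling (w : List (V ⊕ V)) :
    IsPilingOf Γ (wordValue (raagLetter Γ) w) (wordPiling Γ w) := by
  induction w with
  | nil => exact .nil
  | cons x w ih => rw [wordValue_cons]; exact ih.signedGen_mul _ _

theorem pilingAction_wordValue (w : List (V ⊕ V)) :
    (pilingAction Γ (wordValue (raagLetter Γ) w) ⟨fun _ => [], 1, .nil⟩).1 = wordPiling Γ w := by
  induction w with
  | nil => simp [wordValue, wordPiling]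
  | cons x w ih =>
    rw [wordValue_cons, map_mul, Equiv.Perm.mul_apply, pilingAction_signedGen, ih, wordPiling]

theorem wordPiling_eq_of_wordValue_eq {u w : List (V ⊕ V)}
    (h : wordValue (raagLetter Γ) w = wordValue (raagLetter Γ) u) :
    wordPiling Γ w = wordPiling Γ u := by
  rw [← pilingAction_wordValue, h, pilingAction_wordValue]

theorem wordPiling_cons_of_ne {x : V ⊕ V} {w : List (V ⊕ V)}
    (h : (wordPiling Γ w (letterVertex x)).head? ≠ some (some !x.isLeft)) :
    wordPiling Γ (x :: w) = push Γ (letterVertex x) x.isLeft (wordPiling Γ w) := by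
  rw [wordPiling, act, if_neg h]

theorem isGeodesicWord_nil : IsGeodesicWord (raagLetter Γ) [] := fun _ _ => by simp

/-! ### Geodesic words as words without cancellation -/

variable [Fintype V]

/-- The number of signs in a piling. -/
def pilingSize (p : V → List (Option Bool)) : ℕ := ∑ u, (p u).countP Option.isSome

theorem pilingSize_push (v : V) (b : Bool) (p : V → List (Option Bool)) :
    pilingSize (push Γ v b p) = pilingSize p + 1 := by
  classical
  have h (u : V) : (push Γ v b p u).countP Option.isSome =
      (p u).countP Option.isSome + if u = v then 1 else 0 := by
    unfold push
    split_ifs <;> simp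
  simp [pilingSize, h, Finset.sum_add_distrib]

theorem pilingSize_wordPiling_cons_of_eq {x : V ⊕ V} {w : List (V ⊕ V)}
    (h : (wordPiling Γ w (letterVertex x)).head? = some (some !x.isLeft)) :
    pilingSize (wordPiling Γ (x :: w)) + 1 = pilingSize (wordPiling Γ w) := by
  obtain ⟨p', -, hp, -⟩ := (isPilingOf_wordPiling Γ w).exists_eq_push h
  rw [wordPiling, act, if_pos h, hp, pop_push, pilingSize_push]

theorem pilingSize_wordPiling_le (w : List (V ⊕ V)) :
    pilingSize (wordPiling Γ w) ≤ w.length := by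
  induction w with
  | nil => simp [wordPiling, pilingSize]
  | cons x w ih =>
    rw [List.length_cons]
    by_cases h : (wordPiling Γ w (letterVertex x)).head? = some (some !x.isLeft)
    · have := pilingSize_wordPiling_cons_of_eq Γ h
      omega
    · rw [wordPiling_cons_of_ne Γ h, pilingSize_push]
      omega

variable {Γ} in
theorem IsPilingOf.exists_word {g : RAAG Γ} {p : V → List (Option Bool)}
    (hp : IsPilingOf Γ g p) :
    ∃ w, wordValue (raagLetter Γ) w = g ∧ w.length = pilingSize p := by
  induction hp with
  | nil => exact ⟨[], by simp [wordValue, pilingSize]⟩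
  | cons v b hp hv ih =>
    obtain ⟨w, rfl, hw⟩ := ih
    cases b
    · exact ⟨Sum.inr v :: w, wordValue_cons Γ _ _, by simp [pilingSize_push, hw]⟩
    · exact ⟨Sum.inl v :: w, wordValue_cons Γ _ _, by simp [pilingSize_push, hw]⟩

/-- The piling depends only on the value, its size bounds the length of every word below, and
`IsPilingOf.exists_word` attains the bound. -/
theorem isGeodesicWord_iff (w : List (V ⊕ V)) :
    IsGeodesicWord (raagLetter Γ) w ↔ pilingSize (wordPiling Γ w) = w.length := by
  refine ⟨fun h => (pilingSize_wordPiling_le Γ w).antisymm ?_, fun h u hu => ?_⟩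
  · obtain ⟨u, hu, hlen⟩ := (isPilingOf_wordPiling Γ w).exists_word
    exact hlen ▸ h u hu.symm
  · rw [← h, wordPiling_eq_of_wordValue_eq Γ hu]
    exact pilingSize_wordPiling_le Γ u

theorem isGeodesicWord_cons_iff (x : V ⊕ V) (w : List (V ⊕ V)) :
    IsGeodesicWord (raagLetter Γ) (x :: w) ↔ IsGeodesicWord (raagLetter Γ) w ∧
      (wordPiling Γ w (letterVertex x)).head? ≠ some (some !x.isLeft) := by
  rw [isGeodesicWord_iff, isGeodesicWord_iff, List.length_cons]
  by_cases h : (wordPiling Γ w (letterVertex x)).head? = some (some !x.isLeft)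
  · have := pilingSize_wordPiling_cons_of_eq Γ h
    have := pilingSize_wordPiling_le Γ w
    simp only [h, ne_eq, not_true_eq_false, and_false, iff_false]
    omega
  · rw [wordPiling_cons_of_ne Γ h, pilingSize_push, and_iff_left h, Nat.add_right_cancel_iff]

end Piling

/-! ### Tops of pilings and the letters that extend a geodesic word -/

section Counting

open Classical in
/-- The vertices whose pile has a sign on top. -/
noncomputable def pilingTop {V : Type*} [Fintype V] (p : V → List (Option Bool)) : Finset V :=
  {u | ∃ b, (p u).head? = some (some b)}

variable {V : Type*} {Γ : SimpleGraph V}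

variable (Γ) in
/-- The vertices of a link of an edge are the common neighbours of its ends. -/
theorem link_pair_eq {u v : V} (h : Γ.Adj u v) :
    link Γ {u, v} = {w | Γ.Adj w u ∧ Γ.Adj w v} := by
  ext w
  simp only [link, Set.mem_insert_iff, Set.mem_singleton_iff, not_or, Set.mem_ofPred_eq,
    SimpleGraph.isClique_insert]
  constructor
  · rintro ⟨⟨hu, hv⟩, -, h⟩
    exact ⟨h u (by simp) hu, h v (by simp) hv⟩
  · rintro ⟨hu, hv⟩
    refine ⟨⟨hu.ne, hv.ne⟩, ⟨by simp, ?_⟩, ?_⟩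
    · rintro _ rfl _; exact h
    · rintro _ (rfl | rfl) _ <;> assumption

theorem card_filter_adj_le_two [DecidableRel Γ.Adj] (hclique : Γ.CliqueFree 4) {D : Finset V}
    (hD : Γ.IsClique (D : Set V)) (v : V) : (D.filter (Γ.Adj v)).card ≤ 2 := by
  classical
  by_contra! h
  obtain ⟨t, ht, hcard⟩ := Finset.exists_subset_card_eq (Nat.succ_le_of_lt h)
  have hadj (u : V) (hu : u ∈ t) : Γ.Adj v u := (Finset.mem_filter.1 (ht hu)).2
  refine hclique (insert v t) (SimpleGraph.IsNClique.insert ⟨?_, hcard⟩ hadj)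
  exact hD.subset fun u hu => (Finset.mem_filter.1 (ht hu)).1

theorem card_le_three (hclique : Γ.CliqueFree 4) {D : Finset V}
    (hD : Γ.IsClique (D : Set V)) : D.card ≤ 3 := by
  by_contra! h
  obtain ⟨t, ht, hcard⟩ := Finset.exists_subset_card_eq (Nat.succ_le_of_lt h)
  exact hclique t ⟨hD.subset ht, hcard⟩

variable [Fintype V]

variable (Γ) in
theorem finite_geodesicWords (k : ℕ) :
    {w : List (V ⊕ V) | w.length = k ∧ IsGeodesicWord (raagLetter Γ) w}.Finite :=
  (List.finite_length_eq (V ⊕ V) k).subset fun _ h => h.1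

variable (Γ) in
/-- The geodesic words of length `k`. -/
noncomputable def geodesicWords (k : ℕ) : Finset (List (V ⊕ V)) :=
  (finite_geodesicWords Γ k).toFinset

variable (Γ) in
/-- The sum over the geodesic words of length `k` of a function of the size of the top. -/
noncomputable def topSum (f : ℕ → ℚ) (k : ℕ) : ℚ :=
  ∑ w ∈ geodesicWords Γ k, f (pilingTop (wordPiling Γ w)).card

theorem mem_geodesicWords {k : ℕ} {w : List (V ⊕ V)} :
    w ∈ geodesicWords Γ k ↔ w.length = k ∧ IsGeodesicWord (raagLetter Γ) w := by
  simp [geodesicWords]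

theorem topSum_zero (f : ℕ → ℚ) : topSum Γ f 0 = f 0 := by
  have : geodesicWords Γ 0 = {[]} := by
    ext w
    rw [mem_geodesicWords, List.length_eq_zero_iff, Finset.mem_singleton]
    exact ⟨And.left, fun h => ⟨h, h ▸ isGeodesicWord_nil Γ⟩⟩
  simp [topSum, this, wordPiling, pilingTop]

theorem map_geodesicGrowthSeries_eq :
    PowerSeries.map (Int.castRingHom ℚ) (geodesicGrowthSeries (raagLetter Γ)) =
      PowerSeries.mk (topSum Γ fun _ => 1) := by
  ext k
  rw [coeff_map, geodesicGrowthSeries, coeff_mk, coeff_mk, topSum, Finset.sum_const, nsmul_one,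
    Set.ncard_eq_toFinset_card _ (finite_geodesicWords Γ k)]
  simp [geodesicWords]

theorem mem_pilingTop {p : V → List (Option Bool)} {u : V} :
    u ∈ pilingTop p ↔ ∃ b, (p u).head? = some (some b) := by
  simp [pilingTop]

open Classical in
theorem pilingTop_push (v : V) (b : Bool) (p : V → List (Option Bool)) :
    pilingTop (push Γ v b p) = insert v {u ∈ pilingTop p | Γ.Adj v u} := by
  ext u
  rw [mem_pilingTop, Finset.mem_insert, Finset.mem_filter, mem_pilingTop]
  by_cases hu : u = v
  · subst hu
    simp [push_apply_self]
  by_cases h : Γ.Adj v u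
  · simp [push_apply_of_adj h, h, hu]
  · simp [push_apply_of_not_adj hu h, h, hu]

open Classical in
theorem card_pilingTop_push (v : V) (b : Bool) (p : V → List (Option Bool)) :
    (pilingTop (push Γ v b p)).card = {u ∈ pilingTop p | Γ.Adj v u}.card + 1 := by
  rw [pilingTop_push, Finset.card_insert_of_notMem (by simp)]

theorem IsPilingOf.isClique_pilingTop {g : RAAG Γ} {p : V → List (Option Bool)}
    (hp : IsPilingOf Γ g p) : Γ.IsClique (pilingTop p : Set V) := by
  classical
  induction hp with
  | nil => simp [pilingTop]
  | cons v b hp hv ih =>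
    rw [pilingTop_push, Finset.coe_insert, SimpleGraph.isClique_insert]
    refine ⟨ih.subset fun u hu => ?_, fun u hu _ => ?_⟩
    · exact (Finset.mem_filter.1 hu).1
    · exact (Finset.mem_filter.1 hu).2

/-- Summing over the letters that do not cancel on a piling a function of the size of the new
top. -/
theorem sum_letters_eq {R : Type*} [CommRing R] [DecidableRel Γ.Adj]
    {p : V → List (Option Bool)} (hp : Γ.IsClique (pilingTop p : Set V)) (f : ℕ → R) :
    (∑ x : V ⊕ V, if (p (letterVertex x)).head? ≠ some (some !x.isLeft) then
        f ((pilingTop p).filter (Γ.Adj (letterVertex x))).card.succ else 0) =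
      2 * ∑ v, f ((pilingTop p).filter (Γ.Adj v)).card.succ -
        (pilingTop p).card * f (pilingTop p).card := by
  classical
  have key (v : V) :
      ((if (p v).head? ≠ some (some false) then
          f ((pilingTop p).filter (Γ.Adj v)).card.succ else 0) +
        if (p v).head? ≠ some (some true) then
          f ((pilingTop p).filter (Γ.Adj v)).card.succ else 0) =
      2 * f ((pilingTop p).filter (Γ.Adj v)).card.succ -
        if v ∈ pilingTop p then f (pilingTop p).card else 0 := by
    by_cases hv : v ∈ pilingTop p
    -- The top is a clique, so pushing `v` again keeps it unchanged, and exactly one of the two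
    -- signs is excluded by cancellation.
    · have hfil : (pilingTop p).filter (Γ.Adj v) = (pilingTop p).erase v := by
        ext u
        rw [Finset.mem_filter, Finset.mem_erase]
        refine ⟨fun h => ⟨h.2.ne', h.1⟩, fun h => ⟨h.2, hp hv h.2 h.1.symm⟩⟩
      rw [if_pos hv, hfil, Nat.succ_eq_add_one, Finset.card_erase_add_one hv]
      obtain ⟨b, hb⟩ := mem_pilingTop.1 hv
      cases b <;> simp [hb] <;> ring
    · have h (b : Bool) : (p v).head? ≠ some (some b) := fun h => hv (mem_pilingTop.2 ⟨b, h⟩)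
      rw [if_neg hv, if_pos (h _), if_pos (h _)]
      ring
  rw [Fintype.sum_sum_type, ← Finset.sum_add_distrib]
  simp only [letterVertex, Sum.elim_inl, Sum.elim_inr, id, Sum.isLeft_inl, Sum.isLeft_inr,
    Bool.not_true, Bool.not_false]
  refine (Fintype.sum_congr _ _ key).trans ?_
  rw [Finset.sum_sub_distrib, ← Finset.mul_sum,
    Finset.sum_ite_mem, Finset.univ_inter, Finset.sum_const, nsmul_eq_mul]

/-! ### Neighbours in a clique -/

variable [DecidableRel Γ.Adj] {n l q : ℕ}

theorem sum_card_filter_adj (hl : Γ.IsRegularOfDegree l) (D : Finset V) :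
    ∑ v, ((D.filter (Γ.Adj v)).card : ℚ) = D.card * l := by
  have h (u : V) : ∑ v, (if Γ.Adj v u then (1 : ℚ) else 0) = l := by
    rw [← hl u, ← SimpleGraph.card_neighborFinset_eq_degree, SimpleGraph.neighborFinset_eq_filter]
    simp [SimpleGraph.adj_comm]
  simp_rw [Finset.card_filter, Nat.cast_sum, Nat.cast_ite, Nat.cast_one, Nat.cast_zero]
  rw [Finset.sum_comm, Finset.sum_congr rfl fun u _ => h u, Finset.sum_const, nsmul_eq_mul]

/-- Double counting of ordered pairs in `D` with a common neighbour `v`: a diagonal pair contributes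
`l`, an off-diagonal one spans an edge and contributes `q`. -/
theorem sum_card_filter_adj_sq (hl : Γ.IsRegularOfDegree l)
    (hq : ∀ u v : V, Γ.Adj u v → (link Γ {u, v}).ncard = q) {D : Finset V}
    (hD : Γ.IsClique (D : Set V)) :
    ∑ v, ((D.filter (Γ.Adj v)).card : ℚ) ^ 2 = D.card * l + D.card * (D.card - 1) * q := by
  classical
  have hpair {u w : V} (hu : u ∈ D) (hw : w ∈ D) :
      ∑ v, ((if Γ.Adj v u then (1 : ℚ) else 0) * if Γ.Adj v w then 1 else 0) =
        if u = w then (l : ℚ) else q := by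
    simp_rw [mul_ite, mul_one, mul_zero, ← ite_and]
    rw [Finset.sum_boole]
    split_ifs with huw
    · subst huw
      rw [← hl u, ← SimpleGraph.card_neighborFinset_eq_degree,
        SimpleGraph.neighborFinset_eq_filter]
      simp [SimpleGraph.adj_comm]
    · have hadj : Γ.Adj u w := hD hu hw huw
      rw [← hq u w hadj, link_pair_eq Γ hadj, ← Set.ncard_coe_finset]
      simp [and_comm]
  have hrow {u : V} (hu : u ∈ D) :
      ∑ w ∈ D, (if u = w then (l : ℚ) else q) = l + (D.card - 1) * q := by
    rw [← Finset.add_sum_erase D _ hu, if_pos rfl,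
      Finset.sum_congr rfl fun w hw => if_neg (Finset.ne_of_mem_erase hw).symm, Finset.sum_const,
      nsmul_eq_mul, Finset.cast_card_erase_of_mem hu]
  simp_rw [Finset.card_filter, Nat.cast_sum, Nat.cast_ite, Nat.cast_one, Nat.cast_zero, sq,
    Finset.sum_mul_sum]
  rw [Finset.sum_comm, Finset.sum_congr rfl fun u hu => (Finset.sum_comm.trans
    (Finset.sum_congr rfl fun w hw => hpair hu hw)).trans (hrow hu), Finset.sum_const,
    nsmul_eq_mul]
  ring

/-- The number of vertices with a given number of neighbours in a clique depends on its size
only. -/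
theorem sum_apply_card_filter_adj (hn : Fintype.card V = n) (hl : Γ.IsRegularOfDegree l)
    (hq : ∀ u v : V, Γ.Adj u v → (link Γ {u, v}).ncard = q) (hclique : Γ.CliqueFree 4)
    {D : Finset V} (hD : Γ.IsClique (D : Set V)) (f : ℕ → ℚ) :
    ∑ v, f (D.filter (Γ.Adj v)).card.succ =
      n * f 1 + D.card * l * (f 2 - f 1) +
        D.card * (D.card - 1) / 2 * q * (f 3 - 2 * f 2 + f 1) := by
  -- Newton interpolation at the only possible counts 0, 1, 2, so the first two moments suffice.
  have h (v : V) : f (D.filter (Γ.Adj v)).card.succ =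
      f 1 + (D.filter (Γ.Adj v)).card * (f 2 - f 1 - (f 3 - 2 * f 2 + f 1) / 2) +
        ((D.filter (Γ.Adj v)).card : ℚ) ^ 2 * ((f 3 - 2 * f 2 + f 1) / 2) := by
    have := card_filter_adj_le_two hclique hD v
    interval_cases (D.filter (Γ.Adj v)).card <;> norm_num <;> ring
  rw [Finset.sum_congr rfl fun v _ => h v, Finset.sum_add_distrib, Finset.sum_add_distrib,
    ← Finset.sum_mul, ← Finset.sum_mul, sum_card_filter_adj hl, sum_card_filter_adj_sq hl hq hD,
    Finset.sum_const, Finset.card_univ, hn, nsmul_eq_mul]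
  ring

/-! ### The recurrence and its solution -/

theorem topSum_succ_eq_sum (f : ℕ → ℚ) (k : ℕ) :
    topSum Γ f (k + 1) = ∑ w ∈ geodesicWords Γ k, ∑ x : V ⊕ V,
      if (wordPiling Γ w (letterVertex x)).head? ≠ some (some !x.isLeft) then
        f ((pilingTop (wordPiling Γ w)).filter (Γ.Adj (letterVertex x))).card.succ else 0 := by
  classical
  rw [← Finset.sum_product', ← Finset.sum_filter, topSum]
  symm
  refine Finset.sum_bij (fun a _ => a.2 :: a.1) ?_ ?_ ?_ ?_
  · rintro ⟨w, x⟩ h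
    simp only [Finset.mem_filter, Finset.mem_product, mem_geodesicWords] at h
    rw [mem_geodesicWords, isGeodesicWord_cons_iff, List.length_cons]
    exact ⟨by rw [h.1.1.1], h.1.1.2, h.2⟩
  · rintro ⟨w, x⟩ - ⟨w', x'⟩ - h
    simpa [and_comm] using h
  · intro w hw
    rw [mem_geodesicWords] at hw
    obtain ⟨hlen, hw⟩ := hw
    cases w with
    | nil => simp at hlen
    | cons x w =>
      rw [isGeodesicWord_cons_iff] at hw
      refine ⟨(w, x), ?_, rfl⟩
      simp only [Finset.mem_filter, Finset.mem_product, mem_geodesicWords, Finset.mem_univ,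
        and_true]
      exact ⟨⟨by simpa using hlen, hw.1⟩, hw.2⟩
  · rintro ⟨w, x⟩ h
    dsimp only
    rw [wordPiling_cons_of_ne Γ (Finset.mem_filter.1 h).2, card_pilingTop_push, Nat.succ_eq_add_one]
    congr!

/-- The recurrence for the sums over geodesic words. -/
theorem topSum_succ (hn : Fintype.card V = n) (hl : Γ.IsRegularOfDegree l)
    (hq : ∀ u v : V, Γ.Adj u v → (link Γ {u, v}).ncard = q) (hclique : Γ.CliqueFree 4)
    (f g : ℕ → ℚ) (hfg : ∀ j ≤ 3, 2 * (n * f 1 + j * l * (f 2 - f 1) +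
      j * (j - 1) / 2 * q * (f 3 - 2 * f 2 + f 1)) - j * f j = g j) (k : ℕ) :
    topSum Γ f (k + 1) = topSum Γ g k := by
  rw [topSum_succ_eq_sum, topSum]
  refine Finset.sum_congr rfl fun w _ => ?_
  have hD := (isPilingOf_wordPiling Γ w).isClique_pilingTop
  rw [sum_letters_eq hD, sum_apply_card_filter_adj hn hl hq hclique hD,
    hfg _ (card_le_three hclique hD)]

theorem mk_topSum_eq (hn : Fintype.card V = n) (hl : Γ.IsRegularOfDegree l)
    (hq : ∀ u v : V, Γ.Adj u v → (link Γ {u, v}).ncard = q) (hclique : Γ.CliqueFree 4)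
    (f g : ℕ → ℚ) (hfg : ∀ j ≤ 3, 2 * (n * f 1 + j * l * (f 2 - f 1) +
      j * (j - 1) / 2 * q * (f 3 - 2 * f 2 + f 1)) - j * f j = g j) :
    PowerSeries.mk (topSum Γ f) = C (f 0) + X * PowerSeries.mk (topSum Γ g) := by
  ext k
  cases k with
  | zero => simp [topSum_zero]
  | succ k =>
    rw [map_add, coeff_succ_X_mul, coeff_mk, coeff_mk, topSum_succ hn hl hq hclique f g hfg,
      coeff_C, if_neg k.succ_ne_zero, zero_add]

/-- The geodesic growth series, with the denominator cleared. -/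
theorem geodesicGrowthSeries_sub_one_mul (hn : Fintype.card V = n)
    (hl : Γ.IsRegularOfDegree l)
    (hq : ∀ u v : V, Γ.Adj u v → (link Γ {u, v}).ncard = q) (hclique : Γ.CliqueFree 4)
    {N L Q : ℚ⟦X⟧} (hN : N = 2 * (n : ℚ⟦X⟧)) (hL : L = 2 * (l : ℚ⟦X⟧))
    (hQ : Q = 2 * (q : ℚ⟦X⟧)) :
    (PowerSeries.map (Int.castRingHom ℚ) (geodesicGrowthSeries (raagLetter Γ)) - 1) *
      (1 + (6 - N - L - Q) * X
        + (N * L + L * Q + Q * N - 5 * N - 3 * L - Q + 11) * X ^ 2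
        + (3 * N * L + 6 - N * L * Q - 6 * N) * X ^ 3) =
      N * X * (1 + (5 - L - Q) * X + (L * Q - 3 * L + 6) * X ^ 2) := by
  rw [map_geodesicGrowthSeries_eq]
  have lin (c₀ c₁ c₂ c₃ : ℚ) : PowerSeries.mk (topSum Γ fun j => c₀ + c₁ * j +
      c₂ * (j * (j - 1)) + c₃ * (j * (j - 1) * (j - 2))) =
      C c₀ * PowerSeries.mk (topSum Γ fun _ => 1) + C c₁ * PowerSeries.mk (topSum Γ fun j => j) +
        C c₂ * PowerSeries.mk (topSum Γ fun j => j * (j - 1)) +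
        C c₃ * PowerSeries.mk (topSum Γ fun j => j * (j - 1) * (j - 2)) := by
    ext k
    simp [topSum, Finset.sum_add_distrib, Finset.mul_sum, mul_comm]
  -- In the basis of falling factorials the recurrence is tridiagonal.
  have h₀ := mk_topSum_eq hn hl hq hclique (fun _ => 1) (g := fun j =>
    2 * n + (-1) * j + 0 * (j * (j - 1)) + 0 * (j * (j - 1) * (j - 2))) (by
      intro j hj; ring)
  have h₁ := mk_topSum_eq hn hl hq hclique (fun j => (j : ℚ)) (g := fun j =>
    2 * n + (2 * l - 1) * j + (-1) * (j * (j - 1)) + 0 * (j * (j - 1) * (j - 2))) (by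
      intro j hj; push_cast; ring)
  have h₂ := mk_topSum_eq hn hl hq hclique (fun j => (j * (j - 1) : ℚ)) (g := fun j =>
    0 + 4 * l * j + (2 * q - 2) * (j * (j - 1)) + (-1) * (j * (j - 1) * (j - 2))) (by
      intro j hj; push_cast; ring)
  -- The system closes here because `j (j - 1) (j - 2) (j - 3)` vanishes for `j ≤ 3`.
  have h₃ := mk_topSum_eq hn hl hq hclique (fun j => (j * (j - 1) * (j - 2) : ℚ))
    (g := fun j =>
      0 + 0 * j + 6 * q * (j * (j - 1)) + (-3) * (j * (j - 1) * (j - 2))) (by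
      intro j hj; interval_cases j <;> push_cast <;> ring)
  rw [lin] at h₀ h₁ h₂ h₃
  generalize PowerSeries.mk (topSum Γ fun _ => 1) = a at *
  generalize PowerSeries.mk (topSum Γ fun j => (j : ℚ)) = b at *
  generalize PowerSeries.mk (topSum Γ fun j => (j * (j - 1) : ℚ)) = c at *
  generalize PowerSeries.mk (topSum Γ fun j => (j * (j - 1) * (j - 2) : ℚ)) = e at *
  simp only [map_mul, map_sub, map_neg, map_one, map_zero, map_natCast, map_ofNat, Nat.cast_zero,
    zero_mul, zero_add, add_zero] at h₀ h₁ h₂ h₃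
  subst hN hL hQ
  -- The coefficients are the cofactors of the tridiagonal system that eliminate `b`, `c` and `e`.
  linear_combination
    ((1 - (2 * (l : ℚ⟦X⟧) - 1) * X) *
      ((1 - (2 * (q : ℚ⟦X⟧) - 2) * X) * (1 + 3 * X) + 6 * (q : ℚ⟦X⟧) * X ^ 2) +
      4 * (l : ℚ⟦X⟧) * X ^ 2 * (1 + 3 * X)) * h₀ -
    X * ((1 - (2 * (q : ℚ⟦X⟧) - 2) * X) * (1 + 3 * X) + 6 * (q : ℚ⟦X⟧) * X ^ 2) * h₁ +
    X ^ 2 * (1 + 3 * X) * h₂ - X ^ 3 * h₃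

end Counting

end GeodesicGrowth
theorem corollary3p5 {V : Type*} [Fintype V] (Γ : SimpleGraph V) [DecidableRel Γ.Adj]
    (n l q : ℕ) (hreg : GeodesicGrowth.IsLinkRegular Γ) (hn : Fintype.card V = n)
    (hl : Γ.IsRegularOfDegree l)
    (hq : ∀ u v : V, Γ.Adj u v → (GeodesicGrowth.link Γ {u, v}).ncard = q)
    (hclique : Γ.CliqueFree 4) :
    PowerSeries.map (Int.castRingHom ℚ)
        (GeodesicGrowth.geodesicGrowthSeries (GeodesicGrowth.raagLetter Γ)) - 1
      = GeodesicGrowth.coxeterFormula (2 * (n : ℚ⟦X⟧)) (2 * (l : ℚ⟦X⟧)) (2 * (q : ℚ⟦X⟧)) ∧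
    PowerSeries.map (Int.castRingHom ℚ)
        (GeodesicGrowth.geodesicGrowthSeries (GeodesicGrowth.raagLetter Γ)) - 1
      = (2 * (n : ℚ⟦X⟧) * X *
          (1 + (5 - 2 * (l : ℚ⟦X⟧) - 2 * (q : ℚ⟦X⟧)) * X
            + (4 * (l : ℚ⟦X⟧) * (q : ℚ⟦X⟧) - 6 * (l : ℚ⟦X⟧) + 6) * X ^ 2)) *
        (1 + (6 - 2 * (n : ℚ⟦X⟧) - 2 * (l : ℚ⟦X⟧) - 2 * (q : ℚ⟦X⟧)) * X
          + (4 * (n : ℚ⟦X⟧) * (l : ℚ⟦X⟧) + 4 * (l : ℚ⟦X⟧) * (q : ℚ⟦X⟧)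
              + 4 * (q : ℚ⟦X⟧) * (n : ℚ⟦X⟧) - 10 * (n : ℚ⟦X⟧) - 6 * (l : ℚ⟦X⟧)
              - 2 * (q : ℚ⟦X⟧) + 11) * X ^ 2
          + (12 * (n : ℚ⟦X⟧) * (l : ℚ⟦X⟧) + 6
              - 8 * (n : ℚ⟦X⟧) * (l : ℚ⟦X⟧) * (q : ℚ⟦X⟧)
              - 12 * (n : ℚ⟦X⟧)) * X ^ 3)⁻¹ := by
  have key := GeodesicGrowth.geodesicGrowthSeries_sub_one_mul hn hl hq hclique rfl rfl rfl
  constructor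
  · rw [GeodesicGrowth.coxeterFormula, PowerSeries.eq_mul_inv_iff_mul_eq (by simp)]
    exact key
  · rw [PowerSeries.eq_mul_inv_iff_mul_eq (by simp)]
    linear_combination key
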